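/- Let $q$ be a power of a prime $p$, let $e>1$ be an integer and $k$ a prime such that $q=ek+1$, and let $g$ be a generator of the multiplicative group $\mathbb{F}_q^\times$. For $a\in\mathbb{Z}$ put $C_a=\{g^{a},g^{a+e},\dots,g^{a+(k-1)e}\}$, and for $a,b\in\mathbb{Z}$ let the cyclotomic number $(a,b)$ of order $e$ be the number of solutions of $1+x=y$ with $x\in C_a$ and $y\in C_b$. Let $\operatorname{ord}_k(p)$ denote the multiplicative order of $p$ modulo $k$. If $$p>\left(3^{k-1}k\right)^{1/\operatorname{ord}_k(p)},$$ then $(a,b)\le 2$ for all $a,b\in\mathbb{Z}$. -/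

import Mathlib

/-- The cyclotomic class `C_a = {g ^ a, g ^ (a + e), …, g ^ (a + (k - 1) e)}`, as a subset of the
field `F`. -/
def cyclotomicClass {F : Type*} [Field F] (g : Fˣ) (e k : ℕ) (a : ℤ) : Set F :=
  {x | ∃ r : ℕ, r < k ∧ x = ((g ^ (a + (r : ℤ) * (e : ℤ)) : Fˣ) : F)}

/-- The cyclotomic number `(a, b)` of order `e`: the number of solutions of `1 + x = y` with
`x ∈ C_a` and `y ∈ C_b`. -/
noncomputable def cyclotomicNumber {F : Type*} [Field F] (g : Fˣ) (e k : ℕ) (a b : ℤ) : ℕ :=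
  Set.ncard {z : F × F |
    z.1 ∈ cyclotomicClass g e k a ∧ z.2 ∈ cyclotomicClass g e k b ∧ 1 + z.1 = z.2}

/-! Three solutions `1 + X u_i = Y v_i`, with `u_i`, `v_i` all `k`-th roots of unity, make the
determinant with rows `(1, u_i, v_i)` vanish. This equates two sums of three `k`-th roots of unity
that also have equal products and share no term.

Such a relation is impossible when the squares of its collected coefficients add up to `W ≤ 9`. It
lifts to an integer `x` of the `k`-th cyclotomic field lying in the kernel of a map to `F`, whose
image contains a primitive `k`-th root of unity and so has at least `p ^ ord` elements. Hence `x =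
0` or `p ^ ord ≤ |N x|`. Parseval bounds the conjugates: `|N x| ^ 2 ≤ 9 ^ (k - 1) * e` with Euler's
`e`, against the hypothesis on `p`; and `x = 0` forces `k * W = (∑ ε) ^ 2`
(`sum_mul_rootOfUnity_ne_zero`).

When repeated terms push `W` above 9, the equality of products lets the relation be factored into
shorter ones (`two_mul_add_ne`, `three_mul_ne_add_add`). -/

/-! ### Parseval and the norm of a sum of roots of unity -/

open Finset in
theorem sum_pow_mul_conj_pow {k : ℕ} {ω : ℂ} (hω : IsPrimitiveRoot ω k) {a b : ℕ}
    (ha : a < k) (hb : b < k) :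
    ∑ j ∈ range k, (ω ^ j) ^ a * (starRingEnd ℂ) ((ω ^ j) ^ b) = if a = b then (k : ℂ) else 0 := by
  have hk : k ≠ 0 := by omega
  have hn : ‖ω‖ = 1 := hω.norm'_eq_one hk
  have h1 : ω * (starRingEnd ℂ) ω = 1 := by
    rw [Complex.mul_conj, Complex.normSq_eq_norm_sq, hn]; norm_num
  set y := ω ^ a * (starRingEnd ℂ) ω ^ b with hy
  have hterm : ∀ j ∈ range k, (ω ^ j) ^ a * (starRingEnd ℂ) ((ω ^ j) ^ b) = y ^ j := by
    intro j _
    rw [hy, map_pow, map_pow, mul_pow, ← pow_mul, ← pow_mul, ← pow_mul, ← pow_mul,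
      mul_comm j a, mul_comm j b]
  rw [sum_congr rfl hterm]
  split_ifs with hab
  · subst hab
    have : y = 1 := by rw [hy, ← mul_pow, h1, one_pow]
    simp [this]
  · have hy1 : y ≠ 1 := by
      intro h
      apply hab
      apply hω.pow_inj ha hb
      calc ω ^ a = ω ^ a * (ω * (starRingEnd ℂ) ω) ^ b := by rw [h1, one_pow, mul_one]
        _ = y * ω ^ b := by rw [hy, mul_pow]; ring
        _ = ω ^ b := by rw [h, one_mul]
    have hyk : y ^ k = 1 := by
      rw [hy, mul_pow, ← pow_mul, ← pow_mul, mul_comm a, mul_comm b, pow_mul, pow_mul, ← map_pow,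
        hω.pow_eq_one]
      simp
    rw [geom_sum_eq hy1, hyk]
    simp

open Finset in
/-- Parseval's identity for an integer combination of powers of a `k`-th root of unity. -/
theorem sum_normSq_sum_pow {ι : Type*} [Fintype ι] {k : ℕ} {ω : ℂ} (hω : IsPrimitiveRoot ω k)
    (ε : ι → ℤ) (m : ι → ℕ) (hm : ∀ s, m s < k) :
    ∑ j ∈ range k, Complex.normSq (∑ s, (ε s : ℂ) * (ω ^ j) ^ m s) =
      k * ((∑ s, ∑ t, if m s = m t then ε s * ε t else 0 : ℤ) : ℝ) := by
  have h : ((∑ j ∈ range k, Complex.normSq (∑ s, (ε s : ℂ) * (ω ^ j) ^ m s) : ℝ) : ℂ) =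
      ((k * ((∑ s, ∑ t, if m s = m t then ε s * ε t else 0 : ℤ) : ℝ) : ℝ) : ℂ) := by
    push_cast
    simp_rw [← Complex.mul_conj, map_sum, sum_mul_sum]
    rw [sum_comm, mul_sum]
    refine sum_congr rfl fun s _ => ?_
    rw [sum_comm, mul_sum]
    refine sum_congr rfl fun t _ => ?_
    have : ∀ j ∈ range k, (ε s : ℂ) * (ω ^ j) ^ m s * (starRingEnd ℂ) ((ε t : ℂ) * (ω ^ j) ^ m t)
        = (ε s * ε t : ℂ) * ((ω ^ j) ^ m s * (starRingEnd ℂ) ((ω ^ j) ^ m t)) := by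
      intro j _
      rw [map_mul, map_intCast]
      ring
    rw [sum_congr rfl this, ← mul_sum, sum_pow_mul_conj_pow hω (hm s) (hm t)]
    split_ifs
    · push_cast
      ring
    · simp
  exact_mod_cast h

/-- A substitute for AM-GM: `s + 1 ≤ exp s` gives `t ≤ T * exp (t / T - 1)` factor by factor. For `k
- 1` conjugates with sum at most `k * T` the loss is only `exp 1`. -/
theorem prod_le_pow_mul_exp {κ : Type*} (u : Finset κ) (f : κ → ℝ) (hf : ∀ i ∈ u, 0 ≤ f i)
    {T : ℝ} (hT : 0 < T) :
    ∏ i ∈ u, f i ≤ T ^ u.card * Real.exp ((∑ i ∈ u, f i) / T - u.card) := by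
  have h1 : ∀ i ∈ u, f i ≤ T * Real.exp (f i / T - 1) := by
    intro i _
    have := Real.add_one_le_exp (f i / T - 1)
    rw [sub_add_cancel, div_le_iff₀ hT] at this
    linarith
  refine (Finset.prod_le_prod hf h1).trans_eq ?_
  rw [Finset.prod_mul_distrib, Finset.prod_const, ← Real.exp_sum, Finset.sum_sub_distrib,
    Finset.sum_div]
  simp

open Finset in
theorem sum_primitiveRoots_of_prime {k : ℕ} (hk : k.Prime) {ω : ℂ} (hω : IsPrimitiveRoot ω k)
    (f : ℂ → ℝ) : ∑ z ∈ primitiveRoots k ℂ, f z + f 1 = ∑ j ∈ range k, f (ω ^ j) := by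
  have h : range k = insert 0 ((range k).erase 0) := by
    rw [insert_erase]; simpa using hk.pos
  rw [h, sum_insert (by simp), pow_zero, add_comm]
  congr 1
  symm
  refine sum_bij (fun j _ => ω ^ j) ?_ ?_ ?_ ?_
  · intro j hj
    rw [mem_primitiveRoots hk.pos]
    apply hω.pow_of_coprime
    simp only [mem_erase, mem_range] at hj
    exact ((Nat.Prime.coprime_iff_not_dvd hk).2
      (Nat.not_dvd_of_pos_of_lt (by omega) hj.2)).symm
  · intro i hi j hj hij
    simp only [mem_erase, mem_range] at hi hj
    exact hω.pow_inj hi.2 hj.2 hij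
  · intro z hz
    rw [mem_primitiveRoots hk.pos] at hz
    have : NeZero k := ⟨hk.ne_zero⟩
    obtain ⟨i, hi, rfl⟩ := hω.eq_pow_of_pow_eq_one hz.pow_eq_one
    refine ⟨i, ?_, rfl⟩
    simp only [mem_erase, mem_range]
    refine ⟨?_, hi⟩
    rintro rfl
    exact hk.one_lt.ne (by simpa using hz.eq_orderOf.symm)
  · intros; rfl

section Cyclotomic

variable {K : Type*} [Field K] [NumberField K] {k : ℕ} [IsCyclotomicExtension {k} ℚ K] {ζ : K}

theorem sq_norm_sum_pow_le {ι : Type*} [Fintype ι] (hk : k.Prime) (hζ : IsPrimitiveRoot ζ k)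
    (ε : ι → ℤ) (m : ι → ℕ) (hm : ∀ s, m s < k)
    {T : ℕ} (hT : 0 < T) (hW : (∑ s, ∑ t, if m s = m t then ε s * ε t else 0) ≤ (T : ℤ)) :
    ((Algebra.norm ℚ (∑ s, (ε s : K) * ζ ^ m s) : ℚ) : ℝ) ^ 2 ≤
      (T : ℝ) ^ (k - 1) * Real.exp 1 := by
  classical
  have : NeZero k := ⟨hk.ne_zero⟩
  have hirr : Irreducible (Polynomial.cyclotomic k ℚ) :=
    Polynomial.cyclotomic.irreducible_rat hk.pos
  set x := ∑ s, (ε s : K) * ζ ^ m s with hx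
  let g : ℂ → ℝ := fun z => Complex.normSq (∑ s, (ε s : ℂ) * z ^ m s)
  have hω := Complex.isPrimitiveRoot_exp k hk.ne_zero
  have hN : ((Algebra.norm ℚ x : ℚ) : ℂ) = ∏ σ : K →ₐ[ℚ] ℂ, σ x := by
    simpa using Algebra.norm_eq_prod_embeddings ℚ ℂ x
  have hσ : ∀ σ : K →ₐ[ℚ] ℂ, Complex.normSq (σ x) = g (σ ζ) := by
    intro σ
    simp [hx, g]
  have hN2 : ((Algebra.norm ℚ x : ℚ) : ℝ) ^ 2 = ∏ z ∈ primitiveRoots k ℂ, g z := by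
    have h1 := congrArg Complex.normSq hN
    rw [map_prod, Complex.normSq_ratCast, ← sq] at h1
    rw [h1, ← Finset.prod_coe_sort (primitiveRoots k ℂ) g]
    refine Fintype.prod_equiv (hζ.embeddingsEquivPrimitiveRoots ℂ hirr) _ _ fun σ => ?_
    rw [hσ, IsPrimitiveRoot.embeddingsEquivPrimitiveRoots_apply_coe]
  have hsum := sum_primitiveRoots_of_prime hk hω g
  rw [sum_normSq_sum_pow hω ε m hm] at hsum
  have hcard : (primitiveRoots k ℂ).card = k - 1 := by
    rw [Complex.card_primitiveRoots, Nat.totient_prime hk]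
  have hTr : (0 : ℝ) < T := by exact_mod_cast hT
  have hWr : ((∑ s, ∑ t, if m s = m t then ε s * ε t else 0 : ℤ) : ℝ) ≤ (T : ℝ) := by
    exact_mod_cast hW
  rw [hN2]
  refine (prod_le_pow_mul_exp _ g (fun _ _ => Complex.normSq_nonneg _) hTr).trans ?_
  rw [hcard]
  gcongr
  rw [Nat.cast_sub hk.one_lt.le, Nat.cast_one]
  have h1 : ∑ z ∈ primitiveRoots k ℂ, g z ≤ k * T := by
    have := Complex.normSq_nonneg (∑ s, (ε s : ℂ) * (1 : ℂ) ^ m s)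
    have h2 := mul_le_mul_of_nonneg_left hWr (Nat.cast_nonneg (α := ℝ) k)
    simp only [g] at hsum ⊢
    linarith
  have h3 : (∑ z ∈ primitiveRoots k ℂ, g z) / T ≤ k := by
    rwa [div_le_iff₀ hTr]
  linarith

/-- If the sum vanished, so would all its conjugates, and only the term at `1`, namely `(∑ ε) ^ 2`,
would survive in Parseval's identity. -/
theorem sum_pow_ne_zero {ι : Type*} [Fintype ι] (hk : k.Prime) (hζ : IsPrimitiveRoot ζ k)
    (ε : ι → ℤ) (m : ι → ℕ) (hm : ∀ s, m s < k)
    (hW : k * (∑ s, ∑ t, if m s = m t then ε s * ε t else 0) ≠ (∑ s, ε s) ^ 2) :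
    ∑ s, (ε s : K) * ζ ^ m s ≠ 0 := by
  classical
  intro h0
  have : NeZero k := ⟨hk.ne_zero⟩
  have hirr : Irreducible (Polynomial.cyclotomic k ℚ) :=
    Polynomial.cyclotomic.irreducible_rat hk.pos
  let g : ℂ → ℝ := fun z => Complex.normSq (∑ s, (ε s : ℂ) * z ^ m s)
  have hω := Complex.isPrimitiveRoot_exp k hk.ne_zero
  have hsum := sum_primitiveRoots_of_prime hk hω g
  rw [sum_normSq_sum_pow hω ε m hm] at hsum
  have hz : ∀ z ∈ primitiveRoots k ℂ, g z = 0 := by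
    intro z hz
    obtain ⟨σ, hσ⟩ := (hζ.embeddingsEquivPrimitiveRoots ℂ hirr).surjective ⟨z, hz⟩
    have hσz : σ ζ = z := by
      rw [← hζ.embeddingsEquivPrimitiveRoots_apply_coe ℂ hirr, hσ]
    have := congrArg σ h0
    simp only [map_sum, map_mul, map_intCast, map_pow, hσz, map_zero] at this
    simp [g, this]
  rw [Finset.sum_eq_zero hz, zero_add] at hsum
  apply hW
  have h1 : g 1 = ((∑ s, ε s : ℤ) : ℝ) ^ 2 := by
    have : (∑ s, (ε s : ℂ) * (1 : ℂ) ^ m s) = (((∑ s, ε s : ℤ) : ℝ) : ℂ) := by simp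
    simp only [g]
    rw [this, Complex.normSq_ofReal, sq]
  rw [h1] at hsum
  exact_mod_cast hsum.symm

end Cyclotomic

/-! ### Reduction from the cyclotomic integers to the finite field -/

/-- A finite domain is a field, here with `p ^ m` elements; its unit group contains an element of
order `k`, so `p ^ m = 1` modulo `k`. -/
theorem pow_orderOf_le_card_subring {F : Type*} [Field F] [Finite F] {p n k : ℕ} (hp : p.Prime)
    (hF : Nat.card F = p ^ n) {η : F} (hη : IsPrimitiveRoot η k) (hk : k ≠ 0)
    (S : Subring F) (hS : η ∈ S) : p ^ orderOf (p : ZMod k) ≤ Nat.card S := by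
  classical
  have hdvd : Nat.card S ∣ p ^ n := hF ▸ S.toAddSubgroup.card_addSubgroup_dvd_card
  obtain ⟨m, -, hm⟩ := (Nat.dvd_prime_pow hp).1 hdvd
  have : Fintype S := Fintype.ofFinite S
  let : Field S := Fintype.fieldOfDomain S
  have hη' : IsPrimitiveRoot (⟨η, hS⟩ : S) k :=
    IsPrimitiveRoot.of_map_of_injective (f := S.subtype) hη Subtype.val_injective
  have hu : IsUnit (⟨η, hS⟩ : S) := hη'.isUnit hk
  have hord : orderOf hu.unit = k := by
    rw [← orderOf_units, IsUnit.unit_spec, ← hη'.eq_orderOf]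
  have hk' : k ∣ p ^ m - 1 := by
    rw [← hm, ← Nat.card_units, ← hord]
    exact orderOf_dvd_natCard _
  have hm0 : m ≠ 0 := by
    rintro rfl
    have h1 : 1 < Nat.card S := Finite.one_lt_card
    rw [hm, pow_zero] at h1
    exact lt_irrefl _ h1
  have h1 : (p : ZMod k) ^ m = 1 := by
    have := (ZMod.natCast_eq_zero_iff _ _).2 hk'
    rw [Nat.cast_sub (Nat.one_le_pow _ _ hp.pos)] at this
    push_cast at this
    exact sub_eq_zero.1 this
  rw [hm]
  exact Nat.pow_le_pow_right hp.pos (Nat.le_of_dvd (Nat.pos_of_ne_zero hm0) (orderOf_dvd_of_pow_eq_one h1))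

open NumberField in
theorem pow_orderOf_le_natAbs_norm {F : Type*} [Field F] [Finite F] {p n k : ℕ} (hp : p.Prime)
    (hF : Nat.card F = p ^ n) {η : F} (hη : IsPrimitiveRoot η k) (hk : k ≠ 0)
    {K : Type*} [Field K] [NumberField K] (φ : 𝓞 K →+* F) {z : 𝓞 K} (hz : φ z = η)
    {x : 𝓞 K} (hx : φ x = 0) (hx0 : x ≠ 0) :
    p ^ orderOf (p : ZMod k) ≤ (Algebra.norm ℤ x).natAbs := by
  have h1 := Ideal.absNorm_dvd_norm_of_mem (I := RingHom.ker φ) (x := x) hx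
  have h2 : Ideal.absNorm (RingHom.ker φ) = Nat.card φ.range := by
    rw [Ideal.absNorm_apply, Submodule.cardQuot_apply]
    exact Nat.card_congr (RingHom.quotientKerEquivRange φ).toEquiv
  have h3 := pow_orderOf_le_card_subring hp hF hη hk φ.range ⟨z, hz⟩
  rw [← h2] at h3
  refine h3.trans (Nat.le_of_dvd ?_ (Int.natCast_dvd.1 h1))
  rw [Int.natAbs_pos]
  exact Algebra.norm_ne_zero_iff.2 hx0

theorem exp_one_le_natCast_sq {k : ℕ} (hk : 2 ≤ k) : Real.exp 1 ≤ (k : ℝ) ^ 2 := by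
  have h1 : (2 : ℝ) ≤ k := by exact_mod_cast hk
  have h2 := Real.exp_one_lt_d9
  nlinarith

theorem exists_numberField_isCyclotomicExtension (k : ℕ) :
   ∃ (K : Type) (_ : Field K) (_ : NumberField K), IsCyclotomicExtension {k} ℚ K := by
  have h : @IsCyclotomicExtension {k} ℚ (CyclotomicField k ℚ) _ _ (CyclotomicField.algebra k ℚ) := inferInstance
  -- The number field statement uses the canonical `ℚ`-algebra structure, so the instance must be
  -- transported.
  have e : CyclotomicField.algebra k ℚ = DivisionRing.toRatAlgebra := Subsingleton.elim _ _
  rw [e] at h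
  refine ⟨CyclotomicField k ℚ, inferInstance, inferInstance, h⟩

open NumberField in
/-- An integer combination of `k`-th roots of unity in a finite field with small squared
coefficient norm does not vanish, once it does not vanish in characteristic zero. -/
theorem sum_mul_rootOfUnity_ne_zero {F : Type*} [Field F] [Finite F] {p n k : ℕ} (hp : p.Prime)
    (hF : Nat.card F = p ^ n) (hk : k.Prime) {η : F} (hη : IsPrimitiveRoot η k)
    (hbound : 3 ^ (k - 1) * k < p ^ orderOf (p : ZMod k))
    {ι : Type*} [Fintype ι] [DecidableEq F] (ε : ι → ℤ) (A : ι → F) (hA : ∀ s, A s ^ k = 1)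
    (hW : (∑ s, ∑ t, if A s = A t then ε s * ε t else 0) ≤ 9)
    (hne : k * (∑ s, ∑ t, if A s = A t then ε s * ε t else 0) ≠ (∑ s, ε s) ^ 2) :
    ∑ s, (ε s : F) * A s ≠ 0 := by
  intro h0
  have : NeZero k := ⟨hk.ne_zero⟩
  choose m hm hmA using fun s => hη.eq_pow_of_pow_eq_one (hA s)
  have hiff : ∀ s t, A s = A t ↔ m s = m t := fun s t =>
    ⟨fun h => hη.pow_inj (hm s) (hm t) (by rw [hmA, hmA, h]), fun h => by rw [← hmA, ← hmA, h]⟩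
  simp only [hiff] at hW hne
  obtain ⟨K, _, _, _⟩ := exists_numberField_isCyclotomicExtension k
  have hζ : IsPrimitiveRoot (IsCyclotomicExtension.zeta k ℚ K) k :=
    IsCyclotomicExtension.zeta_spec k ℚ K
  have hmin : Polynomial.aeval η (minpoly ℤ hζ.integralPowerBasis.gen) = 0 := by
    rw [IsPrimitiveRoot.integralPowerBasis_gen,
      ← minpoly.algebraMap_eq (B' := K) RingOfIntegers.coe_injective]
    change Polynomial.aeval η (minpoly ℤ (IsCyclotomicExtension.zeta k ℚ K)) = 0
    rw [← Polynomial.cyclotomic_eq_minpoly hζ hk.pos, Polynomial.aeval_def, Polynomial.eval₂_eq_eval_map, Polynomial.map_cyclotomic]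
    exact hη.isRoot_cyclotomic hk.pos
  let φ : 𝓞 K →+* F := (hζ.integralPowerBasis.lift η hmin : 𝓞 K →ₐ[ℤ] F)
  have hφ : φ hζ.toInteger = η := by
    have := hζ.integralPowerBasis.lift_gen η hmin
    rwa [IsPrimitiveRoot.integralPowerBasis_gen] at this
  set x : 𝓞 K := ∑ s, (ε s : 𝓞 K) * hζ.toInteger ^ m s with hx
  have hxK : (x : K) = ∑ s, (ε s : K) * IsCyclotomicExtension.zeta k ℚ K ^ m s := by
    simp only [hx, map_sum, map_mul, map_intCast, map_pow]
    rfl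
  have hφx : φ x = 0 := by
    rw [← h0, hx]
    simp [hφ, hmA]
  have hx0 : x ≠ 0 := by
    intro h
    apply sum_pow_ne_zero hk hζ ε m hm hne
    rw [← hxK, h]
    simp
  have h1 := pow_orderOf_le_natAbs_norm hp hF hη hk.ne_zero φ hφ hφx hx0
  have h2 := sq_norm_sum_pow_le hk hζ ε m hm (T := 9) (by norm_num) (by exact_mod_cast hW)
  rw [← hxK, ← Algebra.coe_norm_int] at h2
  have h3 : ((Algebra.norm ℤ x).natAbs : ℝ) ^ 2 ≤ ((3 : ℝ) ^ (k - 1) * k) ^ 2 := by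
    have : ((Algebra.norm ℤ x).natAbs : ℝ) ^ 2 = (((Algebra.norm ℤ x : ℤ) : ℚ) : ℝ) ^ 2 := by
      rw [Nat.cast_natAbs]
      push_cast
      exact sq_abs _
    rw [this]
    refine h2.trans ?_
    rw [mul_pow, ← pow_mul, mul_comm (k - 1) 2, pow_mul]
    -- The factor `k` in the bound absorbs the square root of `exp 1`.
    have := exp_one_le_natCast_sq hk.two_le
    norm_num
    gcongr
  have h4 := (sq_le_sq₀ (by positivity) (by positivity)).1 h3
  have h5 : (Algebra.norm ℤ x).natAbs ≤ 3 ^ (k - 1) * k := by exact_mod_cast h4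
  omega

/-! ### Cubes and cube roots of unity -/

theorem exists_pow_three_pow_eq {M : Type*} [Monoid M] {k : ℕ} (hk : k.Prime) (hk3 : k ≠ 3) :
    ∃ r : ℕ, ∀ u : M, u ^ k = 1 → (u ^ 3) ^ r = u := by
  obtain ⟨r, -, hr⟩ := Nat.exists_mul_mod_eq_one_of_coprime
    ((Nat.coprime_primes Nat.prime_three hk).2 hk3.symm) hk.one_lt
  exact ⟨r, fun u hu => by rw [← pow_mul, pow_eq_pow_mod _ hu, hr, pow_one]⟩

theorem pow_three_inj {M : Type*} [Monoid M] {k : ℕ} (hk : k.Prime) (hk3 : k ≠ 3) {u v : M}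
    (hu : u ^ k = 1) (hv : v ^ k = 1) (h : u ^ 3 = v ^ 3) : u = v := by
  obtain ⟨r, hr⟩ := exists_pow_three_pow_eq (M := M) hk hk3
  rw [← hr u hu, ← hr v hv, h]

/-- Here `a`, `x`, `y` exhaust the cube roots of unity, so `z` is `x` or `y`, and neither `x ^ 2 *
y` nor `x * y ^ 2` equals `1`. -/
theorem mul_mul_ne_pow_three_of_pow_three_eq_one {F : Type*} [Field F] {a x y z : F}
    (ha : a ^ 3 = 1) (hx : x ^ 3 = 1) (hy : y ^ 3 = 1) (hz : z ^ 3 = 1)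
    (hax : a ≠ x) (hay : a ≠ y) (haz : a ≠ z) (hxy : x ≠ y) : x * y * z ≠ a ^ 3 := by
  have aux : ∀ {u : F}, u ^ 3 = 1 → a ≠ u → u ^ 2 + u * a + a ^ 2 = 0 := fun {u} hu hau =>
    (mul_eq_zero.1 (show (a - u) * (u ^ 2 + u * a + a ^ 2) = 0 by
      linear_combination ha - hu)).resolve_left (sub_ne_zero.2 hau)
  have aux2 : ∀ {u v : F}, u ^ 3 = 1 → v ^ 3 = 1 → a ≠ u → a ≠ v → u ≠ v → u + v + a = 0 :=
    fun {u v} hu hv hau hav huv =>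
    (mul_eq_zero.1 (show (u - v) * (u + v + a) = 0 by
      linear_combination aux hu hau - aux hv hav)).resolve_left (sub_ne_zero.2 huv)
  have hxy' := aux2 hx hy hax hay hxy
  have hx0 : x ≠ 0 := by
    rintro rfl
    norm_num at hx
  have hy0 : y ≠ 0 := by
    rintro rfl
    norm_num at hy
  intro h
  by_cases hzx : z = x
  · subst hzx
    have : z ^ 2 * (y - z) = 0 := by linear_combination h + ha - hz
    exact hxy (sub_eq_zero.1 ((mul_eq_zero.1 this).resolve_left (pow_ne_zero 2 hx0))).symm
  · have hzy : z = y := by linear_combination aux2 hx hz hax haz (Ne.symm hzx) - hxy'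
    subst hzy
    have : z ^ 2 * (x - z) = 0 := by linear_combination h + ha - hz
    exact hxy (sub_eq_zero.1 ((mul_eq_zero.1 this).resolve_left (pow_ne_zero 2 hy0)))

theorem three_mul_ne_three_mul_of_pow_three_eq {F : Type*} [Field F] {k : ℕ} (hk : k.Prime) (h3 : k = 3 → (3 : F) ≠ 0) {a x : F}
    (ha : a ^ k = 1) (hx : x ^ k = 1) (hax : a ≠ x) (hprod : a ^ 3 = x ^ 3) :
    3 * a ≠ 3 * x := by
  by_cases hk3 : k = 3
  · exact fun h => hax (mul_left_cancel₀ (h3 hk3) h)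
  · exact absurd (pow_three_inj hk hk3 ha hx hprod) hax

theorem exists_sorted_triple {F : Type*} [Field F] (P : F → Prop) {a b c : F}
    (ha : P a) (hb : P b) (hc : P c) : ∃ a' b' c', P a' ∧ P b' ∧ P c' ∧
      a + b + c = a' + b' + c' ∧ a * b * c = a' * b' * c' ∧
      ((a' = b' ∧ b' = c') ∨ (a' = b' ∧ b' ≠ c') ∨ (a' ≠ b' ∧ a' ≠ c' ∧ b' ≠ c')) := by
  by_cases hab : a = b
  · exact ⟨a, b, c, ha, hb, hc, rfl, rfl, by tauto⟩
  by_cases hac : a = c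
  · exact ⟨a, c, b, ha, hc, hb, by ring, by ring, Or.inr (Or.inl ⟨hac, hac ▸ hab⟩)⟩
  by_cases hbc : b = c
  · exact ⟨b, c, a, hb, hc, ha, by ring, by ring, Or.inr (Or.inl ⟨hbc, Ne.symm hac⟩)⟩
  · exact ⟨a, b, c, ha, hb, hc, rfl, rfl, by tauto⟩

/-! ### Relations between two triples of roots of unity -/

/-- Integer combinations of `k`-th roots of unity in `F` with squared coefficient norm at most `9`
vanish only if they do so in characteristic zero. -/
def SmallRelationsLift (F : Type*) [Field F] [DecidableEq F] (k : ℕ) : Prop :=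
  ∀ (N : ℕ) (ε : Fin N → ℤ) (A : Fin N → F), (∀ s, A s ^ k = 1) →
    (∑ s, ∑ t, if A s = A t then ε s * ε t else 0) ≤ 9 →
    k * (∑ s, ∑ t, if A s = A t then ε s * ε t else 0) ≠ (∑ s, ε s) ^ 2 →
    ∑ s, (ε s : F) * A s ≠ 0

namespace SmallRelationsLift

variable {F : Type*} [Field F] [DecidableEq F] {k : ℕ}

theorem add_add_ne_of_distinct (H : SmallRelationsLift F k) (hk : k ≠ 0) {a b c x y z : F}
    (ha : a ^ k = 1) (hb : b ^ k = 1) (hc : c ^ k = 1)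
    (hx : x ^ k = 1) (hy : y ^ k = 1) (hz : z ^ k = 1)
    (hab : a ≠ b) (hac : a ≠ c) (hbc : b ≠ c) (hxy : x ≠ y) (hxz : x ≠ z) (hyz : y ≠ z)
    (hax : a ≠ x) (hay : a ≠ y) (haz : a ≠ z) (hbx : b ≠ x) (hby : b ≠ y) (hbz : b ≠ z)
    (hcx : c ≠ x) (hcy : c ≠ y) (hcz : c ≠ z) : a + b + c ≠ x + y + z := by
  intro h
  refine H 6 ![1, 1, 1, -1, -1, -1] ![a, b, c, x, y, z] ?_ ?_ ?_ ?_
  · simp [Fin.forall_fin_succ, *]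
  · simp [Fin.sum_univ_succ, hab.symm, hac.symm, hbc.symm, hxy.symm, hxz.symm, hyz.symm, hax.symm,
      hay.symm, haz.symm, hbx.symm, hby.symm, hbz.symm, hcx.symm, hcy.symm, hcz.symm, *]
  · simp [Fin.sum_univ_succ, hab.symm, hac.symm, hbc.symm, hxy.symm, hxz.symm, hyz.symm, hax.symm,
      hay.symm, haz.symm, hbx.symm, hby.symm, hbz.symm, hcx.symm, hcy.symm, hcz.symm, *]
  · simp [Fin.sum_univ_succ]
    linear_combination h

theorem add_add_ne_two_mul_add (H : SmallRelationsLift F k) (hk : k ≠ 0) {a b c x y : F}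
    (ha : a ^ k = 1) (hb : b ^ k = 1) (hc : c ^ k = 1) (hx : x ^ k = 1) (hy : y ^ k = 1)
    (hab : a ≠ b) (hac : a ≠ c) (hbc : b ≠ c) (hxy : x ≠ y)
    (hax : a ≠ x) (hay : a ≠ y) (hbx : b ≠ x) (hby : b ≠ y) (hcx : c ≠ x) (hcy : c ≠ y) :
    a + b + c ≠ 2 * x + y := by
  intro h
  refine H 5 ![1, 1, 1, -2, -1] ![a, b, c, x, y] ?_ ?_ ?_ ?_
  · simp [Fin.forall_fin_succ, *]
  · simp [Fin.sum_univ_succ, hab.symm, hac.symm, hbc.symm, hxy.symm, hax.symm,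
      hay.symm, hbx.symm, hby.symm, hcx.symm, hcy.symm, *]
  · simp [Fin.sum_univ_succ, hab.symm, hac.symm, hbc.symm, hxy.symm, hax.symm,
      hay.symm, hbx.symm, hby.symm, hcx.symm, hcy.symm, *]
  · simp [Fin.sum_univ_succ]
    linear_combination h

/-- The relation itself can have `W = 10`. Eliminating `b` through the product and dividing by `a -
x` leaves one with `W = 6`, or `W = 2` if `a ^ 2 = y * x`. -/
theorem two_mul_add_ne (H : SmallRelationsLift F k) (hk : k ≠ 0) {a b x y : F}
    (ha : a ^ k = 1) (hx : x ^ k = 1) (hy : y ^ k = 1)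
    (hax : a ≠ x) (hay : a ≠ y) (hprod : a ^ 2 * b = x ^ 2 * y) : 2 * a + b ≠ 2 * x + y := by
  intro h
  have ha0 : a ≠ 0 := by
    rintro rfl
    simp [hk] at ha
  have hy0 : y ≠ 0 := by
    rintro rfl
    simp [hk] at hy
  have h1 : (a - x) * (2 * a ^ 2 - y * a - y * x) = 0 := by
    linear_combination a ^ 2 * h - hprod
  have h2 : 2 * a ^ 2 - y * a - y * x = 0 :=
    (mul_eq_zero.1 h1).resolve_left (sub_ne_zero.2 hax)
  have n1 : a ^ 2 ≠ y * a := fun h => hay (mul_right_cancel₀ ha0 (by rw [← h, sq]))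
  have n2 : y * a ≠ y * x := fun h => hax (mul_left_cancel₀ hy0 h)
  refine H 3 ![2, -1, -1] ![a ^ 2, y * a, y * x] ?_ ?_ ?_ ?_
  · simp [Fin.forall_fin_succ, mul_pow, pow_right_comm _ 2 k, *]
  · by_cases h3 : a ^ 2 = y * x
    · simp [Fin.sum_univ_succ, n1, n1.symm, ← h3]
    · simp [Fin.sum_univ_succ, n1, n2, n1.symm, n2.symm, h3, Ne.symm h3]
  · by_cases h3 : a ^ 2 = y * x
    · simp [Fin.sum_univ_succ, n1, n1.symm, ← h3, hk]
    · simp [Fin.sum_univ_succ, n1, n2, n1.symm, n2.symm, h3, Ne.symm h3, hk]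
  · simp [Fin.sum_univ_succ]
    linear_combination h2

theorem add_add_ne_zero (H : SmallRelationsLift F k) (hk : k.Prime) (hk3 : k ≠ 3) {x y z : F}
    (hx : x ^ k = 1) (hy : y ^ k = 1) (hz : z ^ k = 1) (hne : ¬ (x = y ∧ y = z)) :
    x + y + z ≠ 0 := by
  intro h
  -- The coefficients sum to 3, so a characteristic zero relation would need `k * W = 9`.
  have hdvd : ∀ W : ℤ, (k : ℤ) * W ≠ 9 := by
    intro W hW
    have h1 : (k : ℤ) ∣ ((3 ^ 2 : ℕ) : ℤ) := ⟨W, by rw [hW]; norm_num⟩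
    exact hk3 ((Nat.prime_dvd_prime_iff_eq hk Nat.prime_three).1
      (hk.dvd_of_dvd_pow (Int.natCast_dvd_natCast.1 h1)))
  refine H 3 ![1, 1, 1] ![x, y, z] ?_ ?_ ?_ ?_
  · simp [Fin.forall_fin_succ, *]
  · simp only [Fin.sum_univ_succ]
    simp
    grind
  · have := hdvd
    simp only [Fin.sum_univ_succ]
    simp
    exact this _
  · simp [Fin.sum_univ_succ]
    linear_combination h

theorem sq_add_sq_add_sq_sub_ne_zero (H : SmallRelationsLift F k) (hk : k.Prime)
    (hk3 : k ≠ 3) {x y z : F}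
    (hx : x ^ k = 1) (hy : y ^ k = 1) (hz : z ^ k = 1) (hxy : x ≠ y) (hxz : x ≠ z) (hyz : y ≠ z) :
    x ^ 2 + y ^ 2 + z ^ 2 - x * y - y * z - z * x ≠ 0 := by
  intro h
  have hk0 := hk.ne_zero
  have sq_inj : ∀ {u v : F}, u ^ k = 1 → v ^ k = 1 → u ≠ v → k ≠ 2 → u ^ 2 ≠ v ^ 2 := by
    intro u v hu hv huv hk2 huv2
    have hodd := hk.odd_of_ne_two hk2
    rcases sq_eq_sq_iff_eq_or_eq_neg.1 huv2 with h1 | h1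
    · exact huv h1
    · rw [h1, hodd.neg_pow, hv] at hu
      exact huv (by linear_combination h1 + v * hu)
  have hk2 : k ≠ 2 := by
    rintro rfl
    have h1 := (sq_eq_sq_iff_eq_or_eq_neg.1 (hx.trans hy.symm)).resolve_left hxy
    have h2 := (sq_eq_sq_iff_eq_or_eq_neg.1 (hx.trans hz.symm)).resolve_left hxz
    exact hyz (neg_injective (h1.symm.trans h2))
  have ne0 : ∀ {u : F}, u ^ k = 1 → u ≠ 0 := by
    rintro u hu rfl
    simp [hk0] at hu
  have hx0 := ne0 hx
  have hy0 := ne0 hy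
  have hz0 := ne0 hz
  have s1 := sq_inj hx hy hxy hk2
  have s2 := sq_inj hx hz hxz hk2
  have s3 := sq_inj hy hz hyz hk2
  have c1 : x ^ 2 ≠ x * y := fun h => hxy (mul_left_cancel₀ hx0 (by rw [← h, sq]))
  have c2 : x ^ 2 ≠ z * x := fun h => hxz (mul_right_cancel₀ hx0 (by rw [← h, sq]))
  have c3 : y ^ 2 ≠ x * y := fun h => hxy (mul_right_cancel₀ hy0 (by rw [← h, sq]))
  have c4 : y ^ 2 ≠ y * z := fun h => hyz (mul_left_cancel₀ hy0 (by rw [← h, sq]))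
  have c5 : z ^ 2 ≠ y * z := fun h => hyz (mul_right_cancel₀ hz0 (by rw [← h, sq]))
  have c6 : z ^ 2 ≠ z * x := fun h => hxz (mul_left_cancel₀ hz0 (by rw [← h, sq]))
  have d1 : x * y ≠ y * z := fun h => hxz (mul_left_cancel₀ hy0 (by rw [← h, mul_comm]))
  have d2 : x * y ≠ z * x := fun h => hyz (mul_left_cancel₀ hx0 (by rw [h, mul_comm]))
  have d3 : y * z ≠ z * x := fun h => hxy (mul_left_cancel₀ hz0 (by rw [← h, mul_comm]))
  have hW : ∃ W : ℤ, 0 < W ∧ W ≤ 9 ∧ W = ∑ s, ∑ t, if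
      (![x ^ 2, y ^ 2, z ^ 2, x * y, y * z, z * x] : Fin 6 → F) s =
      (![x ^ 2, y ^ 2, z ^ 2, x * y, y * z, z * x] : Fin 6 → F) t then
      (![1, 1, 1, -1, -1, -1] : Fin 6 → ℤ) s * (![1, 1, 1, -1, -1, -1] : Fin 6 → ℤ) t else 0 := by
    simp only [Fin.sum_univ_succ]
    simp [s1, s2, s3, c1, c2, c3, c4, c5, c6, d1, d2, d3, s1.symm, s2.symm, s3.symm, c1.symm,
      c2.symm, c3.symm, c4.symm, c5.symm, c6.symm, d1.symm, d2.symm, d3.symm]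
    -- Only a square and the opposite product can coincide; `W` drops to 0 only if all three pairs
    -- do, which would give `x ^ 3 = y ^ 3`.
    have hcross : ¬ (x ^ 2 = y * z ∧ y ^ 2 = z * x ∧ z ^ 2 = x * y) := by
      rintro ⟨h1, h2, -⟩
      exact hxy (pow_three_inj hk hk3 hx hy (by linear_combination x * h1 - y * h2))
    simp only [eq_comm (a := x * y), eq_comm (a := y * z), eq_comm (a := z * x)]
    split_ifs <;> first | exact absurd ⟨‹_›, ‹_›, ‹_›⟩ hcross | norm_num
  obtain ⟨W, hW0, hW9, hW⟩ := hW
  refine H 6 ![1, 1, 1, -1, -1, -1] ![x ^ 2, y ^ 2, z ^ 2, x * y, y * z, z * x] ?_ ?_ ?_ ?_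
  · simp [Fin.forall_fin_succ, mul_pow, pow_right_comm _ 2 k, *]
  · rwa [← hW]
  · rw [← hW]
    have : (k : ℤ) * W ≠ 0 := by positivity
    simpa [Fin.sum_univ_succ] using this
  · simp [Fin.sum_univ_succ]
    linear_combination h

/-- Here `W` is at least 12. For `k ≠ 3` cube roots exist among the `k`-th roots of unity, and the
relation becomes `x ^ 3 + y ^ 3 + z ^ 3 = 3 * x * y * z`, whose two classical factors have small
`W`. -/
theorem three_mul_ne_add_add (H : SmallRelationsLift F k) (hk : k.Prime) {a x y z : F}
    (ha : a ^ k = 1) (hx : x ^ k = 1) (hy : y ^ k = 1) (hz : z ^ k = 1)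
    (hax : a ≠ x) (hay : a ≠ y) (haz : a ≠ z) (hne : ¬ (x = y ∧ y = z))
    (hprod : a ^ 3 = x * y * z) : 3 * a ≠ x + y + z := by
  by_cases hk3 : k = 3
  · subst hk3
    by_cases hxy : x = y
    · exact absurd hprod (by
        have := mul_mul_ne_pow_three_of_pow_three_eq_one ha hy hz hx hay haz hax
          (fun h => hne ⟨hxy, h⟩)
        rwa [mul_comm, ← mul_assoc, ne_comm] at this)
    · exact absurd hprod.symm
        (mul_mul_ne_pow_three_of_pow_three_eq_one ha hx hy hz hax hay haz hxy)
  obtain ⟨r, hr⟩ := exists_pow_three_pow_eq (M := F) hk hk3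
  have root : ∀ {u : F}, u ^ k = 1 → ∃ v, v ^ k = 1 ∧ u = v ^ 3 := fun {u} hu =>
    ⟨u ^ r, by rw [pow_right_comm, hu, one_pow], by rw [pow_right_comm, hr u hu]⟩
  obtain ⟨x, hx', rfl⟩ := root hx
  obtain ⟨y, hy', rfl⟩ := root hy
  obtain ⟨z, hz', rfl⟩ := root hz
  have hne' : ¬ (x = y ∧ y = z) := by
    rintro ⟨rfl, rfl⟩
    exact hne ⟨rfl, rfl⟩
  have haxyz : a = x * y * z := pow_three_inj hk hk3 ha
    (by rw [mul_pow, mul_pow, hx', hy', hz', one_mul, one_mul]) (by rw [hprod]; ring)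
  subst haxyz
  intro h
  have h1 : (x + y + z) * (x ^ 2 + y ^ 2 + z ^ 2 - x * y - y * z - z * x) = 0 := by
    linear_combination -h
  have h2 := (mul_eq_zero.1 h1).resolve_left (H.add_add_ne_zero hk hk3 hx' hy' hz' hne')
  have hxy : x ≠ y := by
    rintro rfl
    have : (x - z) ^ 2 = 0 := by linear_combination h2
    exact hne' ⟨rfl, sub_eq_zero.1 (pow_eq_zero_iff two_ne_zero |>.1 this)⟩
  have hxz : x ≠ z := by
    rintro rfl
    have : (x - y) ^ 2 = 0 := by linear_combination h2
    exact hxy (sub_eq_zero.1 (pow_eq_zero_iff two_ne_zero |>.1 this))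
  have hyz : y ≠ z := by
    rintro rfl
    have : (x - y) ^ 2 = 0 := by linear_combination h2
    exact hxy (sub_eq_zero.1 (pow_eq_zero_iff two_ne_zero |>.1 this))
  exact H.sq_add_sq_add_sq_sub_ne_zero hk hk3 hx' hy' hz' hxy hxz hyz h2

/-- Two triples of `k`-th roots of unity in `F` without a common entry cannot agree both in sum
and in product. -/
theorem add_add_ne_of_mul_mul_eq (H : SmallRelationsLift F k) (hk : k.Prime)
    (h3 : k = 3 → (3 : F) ≠ 0) {a b c x y z : F}
    (ha : a ^ k = 1) (hb : b ^ k = 1) (hc : c ^ k = 1)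
    (hx : x ^ k = 1) (hy : y ^ k = 1) (hz : z ^ k = 1)
    (hax : a ≠ x) (hay : a ≠ y) (haz : a ≠ z) (hbx : b ≠ x) (hby : b ≠ y) (hbz : b ≠ z)
    (hcx : c ≠ x) (hcy : c ≠ y) (hcz : c ≠ z) (hprod : a * b * c = x * y * z) :
    a + b + c ≠ x + y + z := by
  have hk0 := hk.ne_zero
  obtain ⟨a, b, c, ⟨ha, hax, hay, haz⟩, ⟨hb, hbx, hby, hbz⟩, ⟨hc, hcx, hcy, hcz⟩, hs, hp, hA⟩ :=
    exists_sorted_triple (fun u => u ^ k = 1 ∧ u ≠ x ∧ u ≠ y ∧ u ≠ z)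
      ⟨ha, hax, hay, haz⟩ ⟨hb, hbx, hby, hbz⟩ ⟨hc, hcx, hcy, hcz⟩
  obtain ⟨x, y, z, ⟨hx, hax, hbx, hcx⟩, ⟨hy, hay, hby, hcy⟩, ⟨hz, haz, hbz, hcz⟩, hs', hp', hX⟩ :=
    exists_sorted_triple (fun u => u ^ k = 1 ∧ a ≠ u ∧ b ≠ u ∧ c ≠ u)
      ⟨hx, hax, hbx, hcx⟩ ⟨hy, hay, hby, hcy⟩ ⟨hz, haz, hbz, hcz⟩
  rw [hp, hp'] at hprod
  rw [hs, hs']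
  clear hs hs' hp hp'
  -- Nine cases, by the multiplicity pattern (triple, double, distinct) on each side.
  rcases hA with ⟨rfl, rfl⟩ | ⟨rfl, hac⟩ | ⟨hab, hac, hbc⟩ <;>
    rcases hX with ⟨rfl, rfl⟩ | ⟨rfl, hxz⟩ | ⟨hxy, hxz, hyz⟩ <;> intro h
  · exact three_mul_ne_three_mul_of_pow_three_eq hk h3 ha hx hax
      (by linear_combination hprod) (by linear_combination h)
  · exact H.three_mul_ne_add_add hk ha hx hx hz hax hax haz (fun h => hxz h.2)
      (by linear_combination hprod) (by linear_combination h)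
  · exact H.three_mul_ne_add_add hk ha hx hy hz hax hay haz (fun h => hxy h.1)
      (by linear_combination hprod) (by linear_combination h)
  · exact H.three_mul_ne_add_add hk hx ha ha hc hax.symm hax.symm hcx.symm (fun h => hac h.2)
      (by linear_combination -hprod) (by linear_combination -h)
  · exact H.two_mul_add_ne (b := c) hk0 ha hx hz hax haz
      (by linear_combination hprod) (by linear_combination h)
  · exact H.add_add_ne_two_mul_add hk0 hx hy hz ha hc hxy hxz hyz hac hax.symm hcx.symm hay.symm
      hcy.symm haz.symm hcz.symm (by linear_combination -h)
  · exact H.three_mul_ne_add_add hk hx ha hb hc hax.symm hbx.symm hcx.symm (fun h => hab h.1)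
      (by linear_combination -hprod) (by linear_combination -h)
  · exact H.add_add_ne_two_mul_add hk0 ha hb hc hx hz hab hac hbc hxz hax haz hbx hbz hcx hcz
      (by linear_combination h)
  · exact H.add_add_ne_of_distinct hk0 ha hb hc hx hy hz hab hac hbc hxy hxz hyz hax hay haz
      hbx hby hbz hcx hcy hcz h

end SmallRelationsLift

/-! ### From three solutions to a relation -/

theorem three_pow_mul_lt_pow_of_rpow_lt {p k f : ℕ} (hf : f ≠ 0)
    (h : (p : ℝ) > ((3 : ℝ) ^ (k - 1) * (k : ℝ)) ^ ((1 : ℝ) / (f : ℝ))) :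
    3 ^ (k - 1) * k < p ^ f := by
  have h1 : (0 : ℝ) ≤ (3 : ℝ) ^ (k - 1) * (k : ℝ) := by positivity
  have h2 := pow_lt_pow_left₀ h (Real.rpow_nonneg h1 _) hf
  rw [one_div, Real.rpow_inv_natCast_pow h1 hf] at h2
  exact_mod_cast h2

theorem exists_rootOfUnity_of_mem_cyclotomicClass {F : Type*} [Field F] {g : Fˣ} {e k : ℕ}
    (hg : g ^ (e * k) = 1) {a : ℤ} {x : F} (hx : x ∈ cyclotomicClass g e k a) :
    ∃ u : F, u ^ k = 1 ∧ x = ((g ^ a : Fˣ) : F) * u := by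
  obtain ⟨r, -, rfl⟩ := hx
  refine ⟨((g ^ (r * e) : Fˣ) : F), ?_, ?_⟩
  · rw [← Units.val_pow_eq_pow_val, ← pow_mul, mul_assoc, mul_comm, pow_mul, hg, one_pow,
      Units.val_one]
  · rw [← Units.val_mul, zpow_add]
    norm_cast

theorem theorem2 {F : Type*} [Field F] [Finite F] (p n q e k : ℕ)
    (hp : p.Prime) (hq : q = p ^ n) (hF : Nat.card F = q)
    (he : 1 < e) (hk : k.Prime) (hqek : q = e * k + 1)
    (g : Fˣ) (hg : ∀ u : Fˣ, u ∈ Subgroup.zpowers g)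
    (hbound : (p : ℝ) >
      ((3 : ℝ) ^ (k - 1) * (k : ℝ)) ^ ((1 : ℝ) / (orderOf (p : ZMod k) : ℝ)))
    (a b : ℤ) :
    cyclotomicNumber g e k a b ≤ 2 := by
  classical
  have hn : n ≠ 0 := by
    rintro rfl
    have := Nat.mul_pos (show 0 < e by omega) hk.pos
    rw [pow_zero] at hq
    omega
  have hpk : p ≠ k := by
    rintro rfl
    have h1 : p ∣ e * p + 1 := hqek ▸ hq ▸ dvd_pow_self p hn
    exact hp.one_lt.ne' (Nat.dvd_one.1 ((Nat.dvd_add_right (dvd_mul_left p e)).1 h1))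
  have hf : orderOf (p : ZMod k) ≠ 0 := by
    have : Fact k.Prime := ⟨hk⟩
    have hunit : IsUnit (p : ZMod k) :=
      (ZMod.isUnit_iff_coprime p k).2 ((Nat.coprime_primes hp hk).2 hpk)
    rw [← IsUnit.unit_spec hunit, orderOf_units]
    exact (orderOf_pos _).ne'
  have hord : orderOf g = e * k := by
    rw [orderOf_eq_card_of_forall_mem_zpowers hg, Nat.card_units, hF, hqek, Nat.add_sub_cancel]
  have hgk : g ^ (e * k) = 1 := hord ▸ pow_orderOf_eq_one g
  have hη : IsPrimitiveRoot ((g ^ e : Fˣ) : F) k :=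
    IsPrimitiveRoot.coe_units_iff.2 ((hord ▸ IsPrimitiveRoot.orderOf g).pow
      (Nat.mul_pos (by omega) hk.pos) rfl)
  have hFp : Nat.card F = p ^ n := hF.trans hq
  have H : SmallRelationsLift F k := fun N ε A hA hW hne =>
    sum_mul_rootOfUnity_ne_zero hp hFp hk hη (three_pow_mul_lt_pow_of_rpow_lt hf hbound)
      ε A hA hW hne
  -- If `3 = 0` in `F`, then `q = 3 * e + 1` would be both 0 and 1 there.
  have h3 : k = 3 → (3 : F) ≠ 0 := by
    rintro rfl h3
    have h4 : ((Nat.card F : ℕ) : F) = 0 := by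
      have := Fintype.ofFinite F
      rw [Nat.card_eq_fintype_card]
      exact Nat.cast_card_eq_zero F
    rw [hF, hqek] at h4
    push_cast at h4
    rw [h3] at h4
    simp at h4
  by_contra! hlt
  unfold cyclotomicNumber at hlt
  rw [Set.two_lt_ncard_iff] at hlt
  obtain ⟨⟨x₁, y₁⟩, ⟨x₂, y₂⟩, ⟨x₃, y₃⟩, ⟨hx₁, hy₁, h₁⟩, ⟨hx₂, hy₂, h₂⟩, ⟨hx₃, hy₃, h₃⟩,
    h12, h13, h23⟩ := hlt
  obtain ⟨u₁, hu₁, rfl⟩ := exists_rootOfUnity_of_mem_cyclotomicClass hgk hx₁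
  obtain ⟨u₂, hu₂, rfl⟩ := exists_rootOfUnity_of_mem_cyclotomicClass hgk hx₂
  obtain ⟨u₃, hu₃, rfl⟩ := exists_rootOfUnity_of_mem_cyclotomicClass hgk hx₃
  obtain ⟨v₁, hv₁, rfl⟩ := exists_rootOfUnity_of_mem_cyclotomicClass hgk hy₁
  obtain ⟨v₂, hv₂, rfl⟩ := exists_rootOfUnity_of_mem_cyclotomicClass hgk hy₂
  obtain ⟨v₃, hv₃, rfl⟩ := exists_rootOfUnity_of_mem_cyclotomicClass hgk hy₃
  have hX : ((g ^ a : Fˣ) : F) ≠ 0 := Units.ne_zero _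
  have hY : ((g ^ b : Fˣ) : F) ≠ 0 := Units.ne_zero _
  simp only at h₁ h₂ h₃
  generalize ((g ^ a : Fˣ) : F) = X at *
  generalize ((g ^ b : Fˣ) : F) = Y at *
  have ne0 : ∀ {u : F}, u ^ k = 1 → u ≠ 0 := by
    rintro u hu rfl
    simp [hk.ne_zero] at hu
  have hpow : ∀ {u v : F}, u ^ k = 1 → v ^ k = 1 → (u * v) ^ k = 1 := fun hu hv => by
    rw [mul_pow, hu, hv, one_mul]
  have hu : ∀ {u v u' v' : F}, 1 + X * u = Y * v → 1 + X * u' = Y * v' →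
      (X * u, Y * v) ≠ (X * u', Y * v') → u ≠ u' ∧ v ≠ v' ∧ u * v' ≠ u' * v := by
    intro u v u' v' h h' hne
    have hne' : u ≠ u' := by
      rintro rfl
      exact hne (by rw [← h, ← h'])
    refine ⟨hne', ?_, ?_⟩
    · rintro rfl
      exact hne' (mul_left_cancel₀ hX (by linear_combination h - h'))
    · intro h2
      have hv : v = v' := by linear_combination v * h' - v' * h + X * h2
      subst hv
      exact hne' (mul_left_cancel₀ hX (by linear_combination h - h'))
  obtain ⟨u12, v12, w12⟩ := hu h₁ h₂ h12
  obtain ⟨u13, v13, w13⟩ := hu h₁ h₃ h13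
  obtain ⟨u23, v23, w23⟩ := hu h₂ h₃ h23
  have hr : ∀ {w u v : F}, w ^ k = 1 → u ≠ v → w * u ≠ w * v := fun hw huv h =>
    huv (mul_left_cancel₀ (ne0 hw) h)
  -- The determinant is expanded into its even and odd permutation terms; both triples have product
  -- `u₁ u₂ u₃ v₁ v₂ v₃`.
  have hdet : Y * ((u₁ * v₂ + u₂ * v₃ + u₃ * v₁) - (u₂ * v₁ + u₃ * v₂ + u₁ * v₃)) = 0 := by
    linear_combination -(u₃ - u₂) * h₁ - (u₁ - u₃) * h₂ - (u₂ - u₁) * h₃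
  refine H.add_add_ne_of_mul_mul_eq hk h3
    (hpow hu₁ hv₂) (hpow hu₂ hv₃) (hpow hu₃ hv₁) (hpow hu₂ hv₁) (hpow hu₃ hv₂) (hpow hu₁ hv₃)
    ?_ ?_ ?_ ?_ ?_ ?_ ?_ ?_ ?_ (by ring)
    (sub_eq_zero.1 ((mul_eq_zero.1 hdet).resolve_left hY))
  · exact w12
  · rw [mul_comm u₁, mul_comm u₃]; exact hr hv₂ u13
  · exact hr hu₁ v23
  · exact hr hu₂ v13.symm
  · exact w23
  · rw [mul_comm u₂, mul_comm u₁]; exact hr hv₃ u12.symm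
  · rw [mul_comm u₃, mul_comm u₂]; exact hr hv₁ u23.symm
  · exact hr hu₃ v12
  · exact w13.symm
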